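/- Let $\mathscr{X}$ be a finite non-empty set (the state space), let $\mathscr{X}^*=\bigcup_{n\ge 0}\mathscr{X}^n$ be the set of situations (finite strings, including the empty one), and let $\Omega=\mathscr{X}^{\mathbb{N}}$ be the set of paths; for $\omega\in\Omega$ write $\omega^n\in\mathscr{X}^n$ for its first $n$ states, and for $s\in\mathscr{X}^n$ let $\Gamma(s)=\{\omega\in\Omega:\omega^n=s\}$. A map into $\overline{\mathbb{R}}=\mathbb{R}\cup\{\pm\infty\}$ is called bounded below if it is everywhere $\ge M$ for some real $M$. For every $s\in\mathscr{X}^*$ let a local upper expectation $\overline{\mathrm{Q}}_s$ be given (an imprecise probabilities tree), that is, a map from the set of all functions $\mathscr{X}\to\overline{\mathbb{R}}$ to $\overline{\mathbb{R}}$ such that, for all bounded-below $f,g:\mathscr{X}\to\overline{\mathbb{R}}$, (E1) $\overline{\mathrm{Q}}_s(c)=c$ for every real constant $c$; (E2) $\overline{\mathrm{Q}}_s(f+g)\le\overline{\mathrm{Q}}_s(f)+\overline{\mathrm{Q}}_s(g)$; (E3) $\overline{\mathrm{Q}}_s(\lambda f)=\lambda\,\overline{\mathrm{Q}}_s(f)$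 for every real $\lambda>0$; (E4) $f\le g$ implies $\overline{\mathrm{Q}}_s(f)\le\overline{\mathrm{Q}}_s(g)$; (E5) $\lim_{n\to\infty}\overline{\mathrm{Q}}_s(f_n)=\overline{\mathrm{Q}}_s(\lim_{n\to\infty}f_n)$ for every non-decreasing sequence $(f_n)_{n\ge0}$ of non-negative functions $\mathscr{X}\to\overline{\mathbb{R}}$. A supermartingale is a map $\mathscr{M}:\mathscr{X}^*\to\overline{\mathbb{R}}$ such that $\overline{\mathrm{Q}}_s(\mathscr{M}(s\,\cdot))\le\mathscr{M}(s)$ for all $s\in\mathscr{X}^*$, where $\mathscr{M}(s\,\cdot)$ is the function $x\mapsto\mathscr{M}(sx)$ on $\mathscr{X}$. For $f:\Omega\to\overline{\mathbb{R}}$ and $s\in\mathscr{X}^*$, the global game-theoretic upper expectation is $$\overline{\mathrm{E}}_{\mathrm{V}}(f\vert s)=\inf\Big\{\mathscr{M}(s):\ \mathscr{M}\text{ is a bounded-below supermartingale and }\liminf_{n\to\infty}\mathscr{M}(\omega^n)\ge f(\omega)\text{ for all }\omega\in\Gamma(s)\Big\}.$$ Then (Fatou's Lemma), for every situation $s\in\mathscr{X}^*$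 and every sequence $(f_n)_{n\ge0}$ of functions $f_n:\Omega\to\overline{\mathbb{R}}$ that is uniformly bounded below (there is a real $M$ with $f_n\ge M$ for all $n$), $$\overline{\mathrm{E}}_{\mathrm{V}}(f\vert s)\le\liminf_{n\to\infty}\overline{\mathrm{E}}_{\mathrm{V}}(f_n\vert s),\qquad\text{where } f=\liminf_{n\to\infty}f_n\text{ pointwise}.$$ -/

import Mathlib

open Filter Topology

namespace GameTheoretic

/-- An extended real variable is bounded below if it is everywhere at least some *real* number. -/
def BoundedBelow {Y : Type*} (f : Y → EReal) : Prop :=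
  ∃ M : ℝ, ∀ y, (M : EReal) ≤ f y

/-- A sequence of extended real variables is uniformly bounded below if one real number bounds
all its members from below. -/
def UniformlyBoundedBelow {Y : Type*} (f : ℕ → Y → EReal) : Prop :=
  ∃ M : ℝ, ∀ n y, (M : EReal) ≤ f n y

/-- Upper expectations on the set of all extended real variables on `Y`. Only bounded-below
variables are constrained. On these, `f + g` never meets `∞ - ∞`, and `const` with `mono` forces
`E f ≠ -∞`, so `E f + E g` does not either: the convention chosen for `∞ - ∞` is irrelevant. -/
structure IsUpperExpectation {Y : Type*} (E : (Y → EReal) → EReal) : Prop where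
  const : ∀ c : ℝ, E (fun _ => (c : EReal)) = c
  subadd : ∀ f g : Y → EReal, BoundedBelow f → BoundedBelow g →
    E (fun y => f y + g y) ≤ E f + E g
  homog : ∀ (r : ℝ) (f : Y → EReal), 0 < r → BoundedBelow f →
    E (fun y => (r : EReal) * f y) = (r : EReal) * E f
  mono : ∀ f g : Y → EReal, BoundedBelow f → BoundedBelow g → (∀ y, f y ≤ g y) → E f ≤ E g
  continuous : ∀ (f : ℕ → Y → EReal) (g : Y → EReal),
    (∀ n y, f n y ≤ f (n + 1) y) → (∀ n y, 0 ≤ f n y) →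
    (∀ y, Tendsto (fun n => f n y) atTop (𝓝 (g y))) →
    Tendsto (fun n => E (f n)) atTop (𝓝 (E g))

/-- A situation is a finite string of states `x₁, …, xₙ`, in order of time; the empty list is the
initial situation. -/
abbrev Situation (X : Type*) := List X

/-- A path is an infinite sequence of states; `ω k` is the state at time `k + 1`. -/
abbrev Path (X : Type*) := ℕ → X

/-- The situation formed by the first `n` states of the path `ω`. -/
def Path.initial {X : Type*} (ω : Path X) (n : ℕ) : Situation X :=
  List.ofFn (fun i : Fin n => ω i)

/-- The cylinder event of all paths that go through the situation `s`. -/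
def cylinder {X : Type*} (s : Situation X) : Set (Path X) :=
  {ω | Path.initial ω s.length = s}

/-- An imprecise probabilities tree: one local upper expectation for every situation. -/
structure ImpreciseProbabilitiesTree (X : Type*) where
  localE : Situation X → (X → EReal) → EReal
  isUpperExpectation : ∀ s, IsUpperExpectation (localE s)

variable {X : Type*}

/-- Supermartingales: extended real processes `M` with `E_s (M (s ·)) ≤ M s` in all situations. -/
def IsSupermartingale (T : ImpreciseProbabilitiesTree X) (M : Situation X → EReal) : Prop :=
  ∀ s, T.localE s (fun x => M (s ++ [x])) ≤ M s

/-- The global variable `liminf M`. -/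
noncomputable def processLiminf (M : Situation X → EReal) (ω : Path X) : EReal :=
  liminf (fun n => M (Path.initial ω n)) atTop

/-- The global game-theoretic upper expectation of `f` conditional on the situation `s`. -/
noncomputable def upperE (T : ImpreciseProbabilitiesTree X) (f : Path X → EReal)
    (s : Situation X) : EReal :=
  sInf {a | ∃ M : Situation X → EReal, IsSupermartingale T M ∧ BoundedBelow M ∧
    (∀ ω ∈ cylinder s, f ω ≤ processLiminf M ω) ∧ a = M s}

end GameTheoretic

namespace GameTheoretic

variable {X : Type*}

/-! ### Paths and situations -/

/-! Adding a constant reduces the claim to `0 ≤ f n`. Passing to the tail infima then reduces it to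
continuity from below (`upperE_iSup_le`) for nonnegative `g n` increasing in `n`. There the process
`S t = ⨆ n, upperE T (g n) t` is a supermartingale by local continuity, and it starts at the desired
bound. What remains is that its limit inferior dominates every `g n`.

This holds outside a null event by Lévy's zero-one law: along almost every path the limit inferior
of `upperE T (g n)` is at least `g n`. The countably many exceptional events are absorbed by a
supermartingale `W` with arbitrarily small initial value and limit `⊤` on all of them
(`exists_supermartingale_processLiminf_eq_top`), so that `S + W` is a competitor in the infimum.

The zero-one law comes from switching supermartingales at stopping times
(`upperE_le_of_forall_exists`): each round improves a uniform bound by the factor `a / b < 1`. -/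

@[simp]
theorem Path.length_initial (ω : Path X) (n : ℕ) : (Path.initial ω n).length = n := by
  simp [Path.initial]

theorem Path.initial_succ (ω : Path X) (n : ℕ) :
    Path.initial ω (n + 1) = Path.initial ω n ++ [ω n] := by
  rw [Path.initial, List.ofFn_succ_last]
  rfl

theorem Path.initial_prefix (ω : Path X) {m n : ℕ} (h : m ≤ n) :
    Path.initial ω m <+: Path.initial ω n := by
  induction n, h using Nat.le_induction with
  | base => exact List.prefix_rfl
  | succ n _ ih =>
    rw [Path.initial_succ]
    exact ih.trans (List.prefix_append _ _)

theorem mem_cylinder_of_prefix_initial {ω : Path X} {s : Situation X} {n : ℕ}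
    (h : s <+: Path.initial ω n) : ω ∈ cylinder s := by
  have hn : s.length ≤ n := by simpa using h.length_le
  have h' := Path.initial_prefix ω hn
  exact (List.prefix_of_prefix_length_le h' h (by simp)).eq_of_length (by simp)

theorem prefix_initial {ω : Path X} {s : Situation X} (h : ω ∈ cylinder s) {n : ℕ}
    (hn : s.length ≤ n) : s <+: Path.initial ω n := by
  have h' := Path.initial_prefix ω hn
  rwa [show Path.initial ω s.length = s from h] at h'

theorem cylinder_subset_of_prefix {s t : Situation X} (h : s <+: t) : cylinder t ⊆ cylinder s :=
  fun _ hω => mem_cylinder_of_prefix_initial (h.trans (prefix_initial hω le_rfl))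

/-- From every situation one can follow a rule choosing the next state, forever. -/
theorem exists_path_of_step (s : Situation X) (next : Situation X → X) :
    ∃ ω ∈ cylinder s, ∀ n, s.length ≤ n → ω n = next (Path.initial ω n) := by
  let L : ℕ → Situation X := fun n => Nat.rec s (fun _ t => t ++ [next t]) n
  have hlen : ∀ n, (L n).length = s.length + n := by
    intro n
    induction n with
    | zero => rfl
    | succ n ih => simp only [L, List.length_append, List.length_singleton] at ih ⊢; omega
  have hmono : ∀ m n, m ≤ n → L m <+: L n := by
    intro m n h
    induction n, h using Nat.le_induction with
    | base => exact List.prefix_rfl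
    | succ n _ ih => exact ih.trans (List.prefix_append _ _)
  let ω : Path X := fun k => (L (k + 1))[k]'(by have := hlen (k + 1); omega)
  have hL : ∀ n, Path.initial ω (s.length + n) = L n := by
    intro n
    apply List.ext_getElem
    · simp [hlen]
    · intro i h₁ h₂
      simp only [Path.initial, List.getElem_ofFn, ω]
      rcases le_total (i + 1) n with h | h
      · exact (hmono _ _ h).getElem _
      · exact ((hmono _ _ h).getElem _).symm
  refine ⟨ω, hL 0, fun n hn => ?_⟩
  obtain ⟨k, rfl⟩ := Nat.exists_eq_add_of_le hn
  have h := hL (k + 1)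
  rw [← add_assoc, Path.initial_succ, show L (k + 1) = L k ++ [next (L k)] from rfl, hL k] at h
  simpa [hL k] using h

/-! ### Supermartingales -/

theorem boundedBelow_of_nonneg {Y : Type*} {f : Y → EReal} (h : ∀ y, 0 ≤ f y) :
    BoundedBelow f :=
  ⟨0, by simpa using h⟩

theorem BoundedBelow.comp {Y Z : Type*} {f : Y → EReal} (h : BoundedBelow f) (e : Z → Y) :
    BoundedBelow (fun z => f (e z)) :=
  h.imp fun _ hM z => hM (e z)

theorem BoundedBelow.add_const {Y : Type*} {f : Y → EReal} (h : BoundedBelow f) (r : ℝ) :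
    BoundedBelow (fun y => f y + (r : EReal)) := by
  obtain ⟨M, hM⟩ := h
  refine ⟨M + r, fun y => ?_⟩
  rw [EReal.coe_add]
  exact add_le_add_left (hM y) _

variable {T : ImpreciseProbabilitiesTree X}

theorem isSupermartingale_const (r : ℝ) : IsSupermartingale T (fun _ => (r : EReal)) :=
  fun s => ((T.isUpperExpectation s).const r).le

theorem IsSupermartingale.add {M N : Situation X → EReal} (hM : IsSupermartingale T M)
    (hN : IsSupermartingale T N) (bM : BoundedBelow M) (bN : BoundedBelow N) :
    IsSupermartingale T (fun t => M t + N t) :=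
  fun s => ((T.isUpperExpectation s).subadd _ _ (bM.comp _) (bN.comp _)).trans
    (add_le_add (hM s) (hN s))

theorem IsSupermartingale.const_mul {M : Situation X → EReal} (hM : IsSupermartingale T M)
    (bM : BoundedBelow M) {r : ℝ} (hr : 0 < r) :
    IsSupermartingale T (fun t => (r : EReal) * M t) := fun s => by
  rw [(T.isUpperExpectation s).homog r _ hr (bM.comp fun x => s ++ [x])]
  exact mul_le_mul_of_nonneg_left (hM s) (by exact_mod_cast hr.le)

theorem IsSupermartingale.sum {M : ℕ → Situation X → EReal}
    (hM : ∀ n, IsSupermartingale T (M n)) (h0 : ∀ n t, 0 ≤ M n t) (n : ℕ) :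
    IsSupermartingale T (fun t => ∑ k ∈ Finset.range n, M k t) := by
  induction n with
  | zero => simpa using isSupermartingale_const (T := T) 0
  | succ n ih =>
    simp only [Finset.sum_range_succ]
    exact ih.add (hM n)
      (boundedBelow_of_nonneg fun t => Finset.sum_nonneg fun k _ => h0 k t)
      (boundedBelow_of_nonneg (h0 n))

theorem IsSupermartingale.iSup {M : ℕ → Situation X → EReal}
    (hM : ∀ n, IsSupermartingale T (M n)) (h0 : ∀ n t, 0 ≤ M n t)
    (hmono : ∀ t, Monotone fun n => M n t) :
    IsSupermartingale T (fun t => ⨆ n, M n t) := fun s =>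
  le_of_tendsto' ((T.isUpperExpectation s).continuous (fun n x => M n (s ++ [x])) _
      (fun n _ => hmono _ n.le_succ) (fun _ _ => h0 _ _)
      (fun _ => tendsto_atTop_iSup (hmono _)))
    (fun n => (hM n s).trans (le_iSup (fun n => M n s) n))

/-- Otherwise, by finiteness of `X`, a real constant fits strictly between `M s` and all the next
values, against `const` and `mono`. -/
theorem IsSupermartingale.exists_le [Finite X] [Nonempty X] {M : Situation X → EReal}
    (hM : IsSupermartingale T M) (bM : BoundedBelow M) (s : Situation X) :
    ∃ x, M (s ++ [x]) ≤ M s := by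
  by_contra! h
  obtain ⟨x₀, hx₀⟩ := Finite.exists_min fun x => M (s ++ [x])
  obtain ⟨q, hq₁, hq₂⟩ := EReal.lt_iff_exists_real_btwn.1 (h x₀)
  have := (T.isUpperExpectation s).mono (fun _ => (q : EReal)) (fun x => M (s ++ [x]))
    ⟨q, fun _ => le_rfl⟩ (bM.comp _) (fun x => hq₂.le.trans (hx₀ x))
  rw [(T.isUpperExpectation s).const] at this
  exact (hq₁.trans_le (this.trans (hM s))).false

/-- A supermartingale is at least as large as the smallest of its limits inferior. -/
theorem IsSupermartingale.le_of_le_processLiminf [Finite X] [Nonempty X] {M : Situation X → EReal}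
    (hM : IsSupermartingale T M) (bM : BoundedBelow M) {s : Situation X} {c : EReal}
    (h : ∀ ω ∈ cylinder s, c ≤ processLiminf M ω) : c ≤ M s := by
  choose next hnext using hM.exists_le bM
  obtain ⟨ω, hω, hstep⟩ := exists_path_of_step s next
  have hle : ∀ n, s.length ≤ n → M (Path.initial ω n) ≤ M s := by
    intro n hn
    induction n, hn using Nat.le_induction with
    | base => rw [show Path.initial ω s.length = s from hω]
    | succ n hn ih =>
      rw [Path.initial_succ, hstep n hn]
      exact (hnext _).trans ih
  exact (h ω hω).trans (liminf_le_of_frequently_le'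
    ((eventually_ge_atTop s.length).mono hle).frequently)

/-! ### Elementary properties of the global upper expectation -/

theorem upperE_le {f : Path X → EReal} {s : Situation X} {M : Situation X → EReal}
    (hM : IsSupermartingale T M) (bM : BoundedBelow M)
    (h : ∀ ω ∈ cylinder s, f ω ≤ processLiminf M ω) : upperE T f s ≤ M s :=
  sInf_le ⟨M, hM, bM, h, rfl⟩

theorem le_upperE {f : Path X → EReal} {s : Situation X} {a : EReal}
    (h : ∀ M, IsSupermartingale T M → BoundedBelow M →
      (∀ ω ∈ cylinder s, f ω ≤ processLiminf M ω) → a ≤ M s) : a ≤ upperE T f s :=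
  le_sInf (by rintro _ ⟨M, hM, bM, hl, rfl⟩; exact h M hM bM hl)

theorem upperE_mono {f g : Path X → EReal} (h : ∀ ω, f ω ≤ g ω) (s : Situation X) :
    upperE T f s ≤ upperE T g s :=
  le_upperE fun _ hM bM hl => upperE_le hM bM fun ω hω => (h ω).trans (hl ω hω)

theorem upperE_le_const {f : Path X → EReal} {c : ℝ} (h : ∀ ω, f ω ≤ c) (s : Situation X) :
    upperE T f s ≤ c :=
  upperE_le (M := fun _ => (c : EReal)) (isSupermartingale_const c) ⟨c, fun _ => le_rfl⟩
    fun ω _ => by simpa [processLiminf] using h ω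

theorem upperE_nonneg [Finite X] [Nonempty X] {f : Path X → EReal} (h : ∀ ω, 0 ≤ f ω)
    (s : Situation X) : 0 ≤ upperE T f s :=
  le_upperE fun _ hM bM hl => hM.le_of_le_processLiminf bM fun ω hω => (h ω).trans (hl ω hω)

/-- A competitor for `f` at `s` is also one at every successor of `s`, so no gluing of near-optimal
supermartingales is needed. -/
theorem isSupermartingale_upperE [Finite X] [Nonempty X] {f : Path X → EReal}
    (h : ∀ ω, 0 ≤ f ω) : IsSupermartingale T (upperE T f) := fun s =>
  le_upperE fun _ hM bM hl =>
    ((T.isUpperExpectation s).mono _ _ (boundedBelow_of_nonneg fun _ => upperE_nonneg h _)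
      (bM.comp _) fun _ => upperE_le hM bM fun ω hω =>
        hl ω (cylinder_subset_of_prefix (List.prefix_append _ _) hω)).trans (hM s)

theorem liminf_add_coe (u : ℕ → EReal) (r : ℝ) :
    liminf (fun n => u n + (r : EReal)) atTop = liminf u atTop + r := by
  have hm : Monotone fun x : EReal => x + (r : EReal) := fun _ _ h => add_le_add_left h _
  refine (hm.map_liminf_of_continuousAt u ?_).symm
  exact ContinuousAt.comp (f := fun x : EReal => (x, (r : EReal)))
    (EReal.continuousAt_add (by simp) (by simp)) (by fun_prop)

theorem upperE_add_const_le (f : Path X → EReal) (r : ℝ) (s : Situation X) :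
    upperE T (fun ω => f ω + (r : EReal)) s ≤ upperE T f s + r := by
  rw [← EReal.sub_le_iff_le_add (by simp) (by simp)]
  refine le_upperE fun M hM bM hl => ?_
  rw [EReal.sub_le_iff_le_add (by simp) (by simp)]
  refine upperE_le (M := fun t => M t + (r : EReal))
    (hM.add (isSupermartingale_const r) bM ⟨r, fun _ => le_rfl⟩) (bM.add_const r) fun ω hω => ?_
  rw [processLiminf, liminf_add_coe]
  exact add_le_add_left (hl ω hω) _

theorem exists_nonneg_supermartingale [Finite X] [Nonempty X] {f : Path X → EReal}
    (h : ∀ ω, 0 ≤ f ω) {s : Situation X} {a : EReal} (ha : upperE T f s < a) :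
    ∃ M, IsSupermartingale T M ∧ (∀ t, 0 ≤ M t) ∧ M s < a ∧
      ∀ ω ∈ cylinder s, f ω ≤ processLiminf M ω := by
  classical
  obtain ⟨_, ⟨M, hM, bM, hl, rfl⟩, hlt⟩ := sInf_lt_iff.1 ha
  have h0 : ∀ t, s <+: t → 0 ≤ M t := fun t ht =>
    hM.le_of_le_processLiminf bM fun ω hω =>
      (h ω).trans (hl ω (cylinder_subset_of_prefix ht hω))
  -- Nonnegativity is only known from `s` onwards; elsewhere the value `⊤` makes the supermartingale
  -- inequality trivial.
  refine ⟨fun t => if s <+: t then M t else ⊤, fun t => ?_, fun t => ?_, by simpa using hlt,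
    fun ω hω => ?_⟩
  · by_cases ht : s <+: t
    · simpa [ht, ht.trans (List.prefix_append t _)] using hM t
    · simp [ht]
  · dsimp only
    split_ifs with ht
    exacts [h0 t ht, le_top]
  · refine (hl ω hω).trans_eq (liminf_congr ?_)
    filter_upwards [eventually_ge_atTop s.length] with n hn
    simp [prefix_initial hω hn]

/-! ### Switching to another supermartingale at a stopping time -/

/-- The shortest prefix belonging to `U` of the reverse of a string. -/
noncomputable def firstHitReverse (U : Set (Situation X)) : List X → Option (Situation X)
  | [] => open Classical in if [] ∈ U then some [] else none
  | x :: r => open Classical in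
    (firstHitReverse U r).or (if (x :: r).reverse ∈ U then some (x :: r).reverse else none)

/-- The shortest prefix of the situation `t` that belongs to `U`. -/
noncomputable def firstHit (U : Set (Situation X)) (t : Situation X) : Option (Situation X) :=
  firstHitReverse U t.reverse

open Classical in
theorem firstHit_concat (U : Set (Situation X)) (t : Situation X) (x : X) :
    firstHit U (t ++ [x]) =
      (firstHit U t).or (if t ++ [x] ∈ U then some (t ++ [x]) else none) := by
  simp [firstHit, firstHitReverse]

theorem firstHit_eq_some {U : Set (Situation X)} {t v : Situation X} :
    firstHit U t = some v → v ∈ U ∧ v <+: t := by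
  classical
  induction t using List.reverseRecOn with
  | nil =>
    simp only [firstHit, List.reverse_nil, firstHitReverse]
    split_ifs with h
    · rintro ⟨⟩; exact ⟨h, List.prefix_rfl⟩
    · simp
  | append_singleton t x ih =>
    rw [firstHit_concat]
    cases ht : firstHit U t with
    | some w =>
      simp only [Option.some_or, Option.some.injEq]
      rintro rfl
      exact ⟨(ih ht).1, (ih ht).2.trans (List.prefix_append _ _)⟩
    | none =>
      simp only [Option.none_or]
      split_ifs with h
      · rintro ⟨⟩; exact ⟨h, List.prefix_rfl⟩
      · simp

theorem firstHit_ne_none {U : Set (Situation X)} {t : Situation X} (h : t ∈ U) :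
    firstHit U t ≠ none := by
  classical
  induction t using List.reverseRecOn with
  | nil => simp [firstHit, firstHitReverse, h]
  | append_singleton t x _ => simp [firstHit_concat, h]

theorem firstHit_initial_of_le {U : Set (Situation X)} {ω : Path X} {m n : ℕ} (hmn : m ≤ n)
    {v : Situation X} (h : firstHit U (Path.initial ω m) = some v) :
    firstHit U (Path.initial ω n) = some v := by
  classical
  induction n, hmn using Nat.le_induction with
  | base => exact h
  | succ n _ ih => simp [Path.initial_succ, firstHit_concat, ih]

/-- The process that follows `M` until a situation `v` in `U` is reached, and `N v` from then on. -/
noncomputable def switch (U : Set (Situation X)) (M : Situation X → EReal)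
    (N : Situation X → Situation X → EReal) (t : Situation X) : EReal :=
  (firstHit U t).elim (M t) fun v => N v t

/-- On entering `U` the value can only drop, so monotonicity of the local expectation suffices. -/
theorem isSupermartingale_switch {U : Set (Situation X)} {M : Situation X → EReal}
    {N : Situation X → Situation X → EReal} (hM : IsSupermartingale T M)
    (hN : ∀ v ∈ U, IsSupermartingale T (N v)) (hM0 : ∀ t, 0 ≤ M t)
    (hN0 : ∀ v ∈ U, ∀ t, 0 ≤ N v t) (hle : ∀ v ∈ U, N v v ≤ M v) :
    IsSupermartingale T (switch U M N) := by
  classical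
  intro t
  cases ht : firstHit U t with
  | some v =>
    simpa [switch, firstHit_concat, ht] using hN v (firstHit_eq_some ht).1 t
  | none =>
    simp only [switch, firstHit_concat, ht, Option.none_or, Option.elim_none]
    refine ((T.isUpperExpectation t).mono _ _ (boundedBelow_of_nonneg fun x => ?_)
      (boundedBelow_of_nonneg fun x => hM0 (t ++ [x])) fun x => ?_).trans (hM t)
    · split_ifs with h
      exacts [hN0 _ h _, hM0 _]
    · split_ifs with h
      exacts [hle _ h, le_rfl]

/-- If a nonnegative supermartingale dominates `f` on every path, unless it exceeds the upper
expectation of `f` at some moment, then it dominates the upper expectation of `f`. -/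
theorem upperE_le_of_forall_exists [Finite X] [Nonempty X] {f : Path X → EReal}
    (hf : ∀ ω, 0 ≤ f ω) {M : Situation X → EReal} (hM : IsSupermartingale T M)
    (hM0 : ∀ t, 0 ≤ M t) {t : Situation X}
    (h : ∀ ω ∈ cylinder t, f ω ≤ processLiminf M ω ∨
      ∃ k, t.length ≤ k ∧ upperE T f (Path.initial ω k) < M (Path.initial ω k)) :
    upperE T f t ≤ M t := by
  -- The condition `t <+: v` rules out a switch before `t`. The strict inequality leaves room for a
  -- supermartingale that dominates `f` and starts below `M v`.
  let U : Set (Situation X) := {v | t <+: v ∧ upperE T f v < M v}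
  have hU : ∀ v, ∃ N : Situation X → EReal, v ∈ U → IsSupermartingale T N ∧ (∀ t, 0 ≤ N t) ∧
      N v < M v ∧ ∀ ω ∈ cylinder v, f ω ≤ processLiminf N ω := by
    intro v
    by_cases hv : v ∈ U
    · exact (exists_nonneg_supermartingale hf hv.2).imp fun N hN _ => hN
    · exact ⟨0, fun h => absurd h hv⟩
  choose N hN using hU
  have hG : IsSupermartingale T (switch U M N) :=
    isSupermartingale_switch hM (fun v hv => (hN v hv).1) hM0 (fun v hv => (hN v hv).2.1)
      fun v hv => (hN v hv).2.2.1.le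
  have hG0 : ∀ u, 0 ≤ switch U M N u := by
    intro u
    cases hu : firstHit U u with
    | some v => simpa [switch, hu] using (hN v (firstHit_eq_some hu).1).2.1 u
    | none => simpa [switch, hu] using hM0 u
  have hGt : switch U M N t ≤ M t := by
    cases ht : firstHit U t with
    | some v =>
      obtain ⟨hv, hvt⟩ := firstHit_eq_some ht
      obtain rfl : v = t := hvt.eq_of_length_le hv.1.length_le
      simpa [switch, ht] using (hN v hv).2.2.1.le
    | none => simp [switch, ht]
  refine (upperE_le hG (boundedBelow_of_nonneg hG0) fun ω hω => ?_).trans hGt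
  by_cases hhit : ∃ k v, firstHit U (Path.initial ω k) = some v
  · obtain ⟨k, v, hk⟩ := hhit
    obtain ⟨hv, hvk⟩ := firstHit_eq_some hk
    refine ((hN v hv).2.2.2 ω (mem_cylinder_of_prefix_initial hvk)).trans_eq (liminf_congr ?_)
    filter_upwards [eventually_ge_atTop k] with n hn
    simp [switch, firstHit_initial_of_le hn hk]
  · have hnone : ∀ k, firstHit U (Path.initial ω k) = none := fun k =>
      Option.eq_none_iff_forall_ne_some.2 fun v hv => hhit ⟨k, v, hv⟩
    rcases h ω hω with h | ⟨k, hk, hlt⟩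
    · exact h.trans_eq (by simp [processLiminf, switch, hnone])
    · exact absurd (hnone k) (firstHit_ne_none ⟨prefix_initial hω hk, hlt⟩)

/-! ### Null events -/

/-- One step of the proof of Lévy's zero-one law. -/
theorem upperE_le_div_mul [Finite X] [Nonempty X] {f g : Path X → EReal} (hf : ∀ ω, 0 ≤ f ω)
    (hg : ∀ ω, 0 ≤ g ω) {a b : ℝ} (ha : 0 < a) (hb : 0 < b)
    (hfg : ∀ ω, g ω = 0 ∨ ((∃ᶠ k in atTop, upperE T f (Path.initial ω k) < a) ∧ b < f ω))
    {c : ℝ} (hc0 : 0 ≤ c) (hc : ∀ t, upperE T g t ≤ c) (t : Situation X) :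
    upperE T g t ≤ ((a / b * c : ℝ) : EReal) := by
  refine EReal.le_of_forall_lt_iff_le.1 fun e he => ?_
  have he : a / b * c < e := by exact_mod_cast he
  have he0 : 0 < e := lt_of_le_of_lt (by positivity) he
  have hd : c < e / a * b := by
    rw [div_mul_eq_mul_div, lt_div_iff₀ ha]
    rw [div_mul_eq_mul_div, div_lt_iff₀ hb] at he
    linarith
  -- A supermartingale for `f` starting below `a`, scaled by `e / a`, starts below `e`. Where `b <
  -- f` it eventually exceeds `e / a * b > c`, hence the upper expectation of `g`, and a switch is
  -- possible.
  have key : ∀ u, upperE T f u < a → upperE T g u < e := by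
    intro u hu
    obtain ⟨M, hM, hM0, hMu, hMl⟩ := exists_nonneg_supermartingale hf hu
    have hr : 0 < e / a := by positivity
    have hr' : (0 : EReal) ≤ ((e / a : ℝ) : EReal) := by exact_mod_cast hr.le
    refine (upperE_le_of_forall_exists (M := fun t => ((e / a : ℝ) : EReal) * M t) hg
      (hM.const_mul (boundedBelow_of_nonneg hM0) hr) (fun t => mul_nonneg hr' (hM0 t))
      fun ω hω => ?_).trans_lt ?_
    · rcases hfg ω with h0 | ⟨-, hbf⟩
      · left
        rw [h0]
        exact le_liminf_of_le (by isBoundedDefault)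
          (Eventually.of_forall fun n => mul_nonneg hr' (hM0 _))
      · right
        have hlt : (b : EReal) < processLiminf M ω := hbf.trans_le (hMl ω hω)
        obtain ⟨k, hk, hbk⟩ := ((eventually_ge_atTop u.length).and
          (eventually_lt_of_lt_liminf hlt)).exists
        refine ⟨k, hk, (hc _).trans_lt ?_⟩
        calc (c : EReal) < ((e / a * b : ℝ) : EReal) := by exact_mod_cast hd
          _ = ((e / a : ℝ) : EReal) * b := EReal.coe_mul _ _
          _ ≤ _ := mul_le_mul_of_nonneg_left hbk.le hr'
    · have hM_top : M u ≠ ⊤ := (hMu.trans (EReal.coe_lt_top a)).ne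
      have hM_bot : M u ≠ ⊥ := (EReal.bot_lt_zero.trans_le (hM0 u)).ne'
      lift M u to ℝ using ⟨hM_top, hM_bot⟩ with m
      have hm : m < a := by exact_mod_cast hMu
      have : e / a * m < e := by
        calc e / a * m < e / a * a := by gcongr
          _ = e := div_mul_cancel₀ e ha.ne'
      exact_mod_cast this
  -- From an arbitrary `t`, the constant `e` is held until the upper expectation of `f` is below
  -- `a`.
  refine upperE_le_of_forall_exists (M := fun _ => (e : EReal)) hg (isSupermartingale_const e)
    (fun _ => by exact_mod_cast he0.le) fun ω hω => ?_
  rcases hfg ω with h0 | ⟨hfr, -⟩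
  · left
    simpa [h0, processLiminf] using he0.le
  · right
    obtain ⟨k, hlt, hk⟩ := (hfr.and_eventually (eventually_ge_atTop t.length)).exists
    exact ⟨k, hk, key _ hlt⟩

/-- Lévy's zero-one law: it is a null event that the upper expectation of `f` is infinitely often
below `a` although `f` exceeds `b > a`. -/
theorem upperE_nonpos_of_frequently_lt [Finite X] [Nonempty X] {f g : Path X → EReal}
    (hf : ∀ ω, 0 ≤ f ω) (hg : ∀ ω, 0 ≤ g ω) {a b : ℝ} (ha : 0 < a) (hab : a < b)
    (hfg : ∀ ω, g ω = 0 ∨ ((∃ᶠ k in atTop, upperE T f (Path.initial ω k) < a) ∧ b < f ω))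
    {m : ℝ} (hm : 0 ≤ m) (hgm : ∀ ω, g ω ≤ m) (t : Situation X) : upperE T g t ≤ 0 := by
  have hb : 0 < b := ha.trans hab
  have hn : ∀ (n : ℕ) t, upperE T g t ≤ (((a / b) ^ n * m : ℝ) : EReal) := by
    intro n
    induction n with
    | zero => simpa using upperE_le_const hgm
    | succ n ih =>
      intro t
      have := upperE_le_div_mul hf hg ha hb hfg (by positivity) ih t
      rwa [← mul_assoc, ← pow_succ'] at this
  have hlim : Tendsto (fun n : ℕ => (a / b) ^ n * m) atTop (𝓝 0) := by
    simpa using (tendsto_pow_atTop_nhds_zero_of_lt_one (by positivity)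
      ((div_lt_one hb).2 hab)).mul_const m
  exact ge_of_tendsto' ((continuous_coe_real_ereal.tendsto 0).comp hlim) fun n => hn n t

/-- Countably many of the null events in `upperE_nonpos_of_frequently_lt` can be avoided at the
same time. -/
theorem exists_supermartingale_processLiminf_eq_top [Finite X] [Nonempty X]
    {f : ℕ → Path X → EReal} (hf : ∀ n ω, 0 ≤ f n ω) (s : Situation X) {ε : ℝ} (hε : 0 < ε) :
    ∃ W, IsSupermartingale T W ∧ (∀ t, 0 ≤ W t) ∧ W s ≤ ε ∧
      ∀ n, ∀ ω ∈ cylinder s, processLiminf (upperE T (f n)) ω < f n ω →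
        processLiminf W ω = ⊤ := by
  classical
  let A : ℕ × ℚ × ℚ → Set (Path X) := fun p =>
    {ω | (0 : ℝ) < p.2.1 ∧ (p.2.1 : ℝ) < p.2.2 ∧
      (∃ᶠ k in atTop, upperE T (f p.1) (Path.initial ω k) < ((p.2.1 : ℝ) : EReal)) ∧
      ((p.2.2 : ℝ) : EReal) < f p.1 ω}
  -- All heights `m` are used, so that the sum of the resulting supermartingales has limit inferior
  -- `⊤` on each `A p`.
  have hnull : ∀ p (m : ℕ), upperE T ((A p).indicator fun _ => ((m : ℝ) : EReal)) s ≤ 0 := by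
    intro p m
    have hm : (0 : EReal) ≤ ((m : ℝ) : EReal) := by exact_mod_cast m.cast_nonneg
    have hg : ∀ ω, 0 ≤ (A p).indicator (fun _ => ((m : ℝ) : EReal)) ω :=
      Set.indicator_nonneg fun _ _ => hm
    have hgm : ∀ ω, (A p).indicator (fun _ => ((m : ℝ) : EReal)) ω ≤ ((m : ℝ) : EReal) :=
      fun ω => Set.indicator_apply_le' (fun _ => le_rfl) fun _ => hm
    by_cases hp : (0 : ℝ) < p.2.1 ∧ (p.2.1 : ℝ) < p.2.2
    · refine upperE_nonpos_of_frequently_lt (hf p.1) hg hp.1 hp.2 (fun ω => ?_)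
        m.cast_nonneg hgm s
      by_cases hω : ω ∈ A p
      · exact Or.inr hω.2.2
      · exact Or.inl (Set.indicator_of_notMem hω _)
    · refine upperE_le_const (c := 0) (fun ω => ?_) s
      rw [Set.indicator_of_notMem fun h => hp ⟨h.1, h.2.1⟩]
      rfl
  obtain ⟨e, he⟩ := exists_surjective_nat ((ℕ × ℚ × ℚ) × ℕ)
  obtain ⟨δ, hδ, c, hδc, hcε⟩ := posSumOfEncodable hε ℕ
  have hT : ∀ k, ∃ M, IsSupermartingale T M ∧ (∀ t, 0 ≤ M t) ∧ M s < (δ k : EReal) ∧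
      ∀ ω ∈ cylinder s, (A (e k).1).indicator (fun _ => (((e k).2 : ℝ) : EReal)) ω ≤
        processLiminf M ω := by
    intro k
    refine exists_nonneg_supermartingale (Set.indicator_nonneg fun _ _ => ?_)
      ((hnull _ _).trans_lt ?_)
    · exact_mod_cast (e k).2.cast_nonneg
    · exact_mod_cast hδ k
  choose M hM hM0 hMs hMl using hT
  have hmono : ∀ t, Monotone fun n => ∑ k ∈ Finset.range n, M k t := fun t m n hmn =>
    Finset.sum_le_sum_of_subset_of_nonneg (Finset.range_mono hmn) fun k _ _ => hM0 k t
  have hnn : ∀ n t, 0 ≤ ∑ k ∈ Finset.range n, M k t := fun n t =>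
    Finset.sum_nonneg fun k _ => hM0 k t
  have hle : ∀ k t, M k t ≤ ⨆ n, ∑ k ∈ Finset.range n, M k t := fun k t =>
    (Finset.single_le_sum (f := fun k => M k t) (fun j _ => hM0 j t)
      (Finset.self_mem_range_succ k)).trans
      (le_iSup (fun n => ∑ k ∈ Finset.range n, M k t) (k + 1))
  refine ⟨fun t => ⨆ n, ∑ k ∈ Finset.range n, M k t,
    IsSupermartingale.iSup (IsSupermartingale.sum hM hM0) hnn hmono,
    fun t => (hM0 0 t).trans (hle 0 t), iSup_le fun n => ?_, fun n ω hω hlt => ?_⟩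
  · calc ∑ k ∈ Finset.range n, M k s ≤ ∑ k ∈ Finset.range n, (δ k : EReal) :=
        Finset.sum_le_sum fun k _ => (hMs k).le
      _ = ((∑ k ∈ Finset.range n, δ k : ℝ) : EReal) := by
        induction n with
        | zero => simp
        | succ n ih => rw [Finset.sum_range_succ, Finset.sum_range_succ, ih, EReal.coe_add]
      _ ≤ ε := by
        exact_mod_cast (sum_le_hasSum _ (fun k _ => (hδ k).le) hδc).trans hcε
  -- Two rationals between the limit inferior and `f n ω` place `ω` in one of the events; the
  -- smaller is positive because upper expectations of `f n` are nonnegative.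
  · obtain ⟨b, hab, hb⟩ := EReal.lt_iff_exists_rat_btwn.1 hlt
    obtain ⟨a, ha, hab⟩ := EReal.lt_iff_exists_rat_btwn.1 hab
    have h0 : 0 ≤ processLiminf (upperE T (f n)) ω :=
      le_liminf_of_le (by isBoundedDefault)
        (Eventually.of_forall fun _ => upperE_nonneg (hf n) _)
    have hmem : ω ∈ A (n, a, b) :=
      ⟨by exact_mod_cast h0.trans_lt ha, by exact_mod_cast hab,
        frequently_lt_of_liminf_lt (by isBoundedDefault) ha, hb⟩
    rw [EReal.eq_top_iff_forall_lt]
    intro y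
    obtain ⟨m, hm⟩ := exists_nat_gt y
    obtain ⟨k, hk⟩ := he ((n, a, b), m)
    have hkl := hMl k ω hω
    rw [hk, Set.indicator_of_mem hmem] at hkl
    exact (EReal.coe_lt_coe_iff.2 hm).trans_le
      (hkl.trans (liminf_le_liminf (Eventually.of_forall fun _ => hle k _)))

/-! ### Convergence theorems -/

/-- Continuity from below of the global upper expectation. -/
theorem upperE_iSup_le [Finite X] [Nonempty X] {g : ℕ → Path X → EReal}
    (hg : ∀ n ω, 0 ≤ g n ω) (hmono : Monotone g) (s : Situation X) :
    upperE T (fun ω => ⨆ n, g n ω) s ≤ ⨆ n, upperE T (g n) s := by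
  have hV0 : ∀ n t, 0 ≤ upperE T (g n) t := fun n => upperE_nonneg (hg n)
  have hS : IsSupermartingale T fun t => ⨆ n, upperE T (g n) t :=
    IsSupermartingale.iSup (fun n => isSupermartingale_upperE (hg n)) hV0
      fun t _ _ hmn => upperE_mono (hmono hmn) t
  have hS0 : ∀ t, 0 ≤ ⨆ n, upperE T (g n) t := fun t =>
    (hV0 0 t).trans (le_iSup (fun n => upperE T (g n) t) 0)
  suffices H : ∀ ε : ℝ, 0 < ε →
      upperE T (fun ω => ⨆ n, g n ω) s ≤ (⨆ n, upperE T (g n) s) + (ε : EReal) by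
    refine EReal.le_of_forall_lt_iff_le.1 fun z hz => ?_
    have hs0 := hS0 s
    lift (⨆ n, upperE T (g n) s) to ℝ using
      ⟨(hz.trans (EReal.coe_lt_top z)).ne, (EReal.bot_lt_zero.trans_le hs0).ne'⟩ with r
    refine (H (z - r) (sub_pos.2 (EReal.coe_lt_coe_iff.1 hz))).trans_eq ?_
    rw [← EReal.coe_add, add_sub_cancel]
  intro ε hε
  obtain ⟨W, hW, hW0, hWs, hWl⟩ :=
    exists_supermartingale_processLiminf_eq_top (T := T) hg s hε
  refine (upperE_le (hS.add hW (boundedBelow_of_nonneg hS0) (boundedBelow_of_nonneg hW0))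
    (boundedBelow_of_nonneg fun t => add_nonneg (hS0 t) (hW0 t)) fun ω hω =>
      iSup_le fun n => ?_).trans (add_le_add_right hWs _)
  -- On exceptional paths `W` alone dominates `g n`; on the others `S` does.
  rcases lt_or_ge (processLiminf (upperE T (g n)) ω) (g n ω) with hlt | hle
  · refine le_top.trans ((hWl n ω hω hlt).ge.trans (liminf_le_liminf ?_))
    exact Eventually.of_forall fun k => le_add_of_nonneg_left (hS0 _)
  · refine hle.trans (liminf_le_liminf (Eventually.of_forall fun k => ?_))
    exact (le_iSup (fun n => upperE T (g n) (Path.initial ω k)) n).trans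
      (le_add_of_nonneg_right (hW0 _))

/-- Fatou's lemma for nonnegative variables. -/
theorem upperE_liminf_le_of_nonneg [Finite X] [Nonempty X] {f : ℕ → Path X → EReal}
    (hf : ∀ n ω, 0 ≤ f n ω) (s : Situation X) :
    upperE T (fun ω => liminf (fun n => f n ω) atTop) s ≤
      liminf (fun n => upperE T (f n) s) atTop := by
  simp only [liminf_eq_iSup_iInf_of_nat]
  refine (upperE_iSup_le (g := fun n ω => ⨅ i ≥ n, f i ω)
    (fun n ω => le_iInf₂ fun i _ => hf i ω)
    (fun m n hmn ω => le_iInf₂ fun i hi => iInf₂_le i (hmn.trans hi)) s).trans ?_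
  exact iSup_mono fun n => le_iInf₂ fun i hi => upperE_mono (fun ω => iInf₂_le i hi) s

end GameTheoretic

/-! ### Reduction to nonnegative variables by a shift -/

theorem mainTheorem7 {X : Type*} [Finite X] [Nonempty X]
    (T : GameTheoretic.ImpreciseProbabilitiesTree X) (s : GameTheoretic.Situation X)
    (f : ℕ → GameTheoretic.Path X → EReal) (hf : GameTheoretic.UniformlyBoundedBelow f) :
    GameTheoretic.upperE T (fun ω => liminf (fun n => f n ω) atTop) s ≤
      liminf (fun n => GameTheoretic.upperE T (f n) s) atTop := by
  obtain ⟨M, hM⟩ := hf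
  have hcancel : ∀ x : EReal, x + ((-M : ℝ) : EReal) + (M : EReal) = x := fun x => by
    rw [add_assoc, ← EReal.coe_add, neg_add_cancel, EReal.coe_zero, add_zero]
  have h0 : ∀ n ω, 0 ≤ f n ω + ((-M : ℝ) : EReal) := fun n ω => by
    calc (0 : EReal) = (M : EReal) + ((-M : ℝ) : EReal) := by
          rw [← EReal.coe_add, add_neg_cancel, EReal.coe_zero]
      _ ≤ _ := add_le_add_left (hM n ω) _
  have h := GameTheoretic.upperE_liminf_le_of_nonneg (T := T) h0 s
  simp only [GameTheoretic.liminf_add_coe] at h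
  calc GameTheoretic.upperE T (fun ω => liminf (fun n => f n ω) atTop) s
      = GameTheoretic.upperE T
          (fun ω => liminf (fun n => f n ω) atTop + ((-M : ℝ) : EReal) + (M : EReal)) s := by
        simp only [hcancel]
    _ ≤ GameTheoretic.upperE T (fun ω => liminf (fun n => f n ω) atTop + ((-M : ℝ) : EReal)) s
          + M := GameTheoretic.upperE_add_const_le _ _ _
    _ ≤ liminf (fun n => GameTheoretic.upperE T (f n) s + ((-M : ℝ) : EReal)) atTop + M :=
        add_le_add_left (h.trans (liminf_le_liminf (Eventually.of_forall fun n =>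
          GameTheoretic.upperE_add_const_le _ _ _))) _
    _ = liminf (fun n => GameTheoretic.upperE T (f n) s) atTop := by
        rw [GameTheoretic.liminf_add_coe, hcancel]
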